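/- For a finite set $U=\{u_1<u_2<\dots<u_{2^N}\}\subset\mathbb{R}$ with $2^N$ elements, let its Perron factor be $$G_U:=\sup_{\substack{k,l\ge 1\\ k+2l\le 2^N}}\left(\frac{u_{k+2l}-u_{k+l}}{u_{k+l}-u_k}+\frac{u_{k+l}-u_k}{u_{k+2l}-u_{k+l}}\right).$$ For a set of slopes $\Omega\subset\mathbb{R}$, let its Perron capacity be $$P_\Omega:=\liminf_{N\to\infty}\ \inf_{\substack{U\subset\Omega\\ \#U=2^N}}G_U\ \in[2,\infty],$$ where the infimum over the empty family is $\infty$. Let $\mathcal{R}_\Omega$ be the family of all nondegenerate rectangles $R$ of the plane whose longest side makes with the $x$-axis an angle $\omega_R\in[0,\pi)\setminus\{\pi/2\}$ such that $\tan\omega_R\in\Omega$, and let the directional maximal operator $M_\Omega$ be defined by $$M_\Omega f(x):=\sup_{x\in R\in\mathcal{R}_\Omega}\frac1{|R|}\int_R|f|.$$ **Theorem.** Let $\Omega\subset\mathbb{R}$ be any set of slopes such that $P_\Omega<\infty$. Then for every $p\in(1,\infty)$ one has $\|M_\Omega\|_p=\infty$, where $\|M_\Omega\|_p\in[0,\infty]$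 is the operator norm of $M_\Omega$ on $L^p(\mathbb{R}^2)$; that is, there is no finite constant $C$ such that $\|M_\Omega f\|_p\le C\|f\|_p$ for all $f\in L^p(\mathbb{R}^2)$. -/

import Mathlib

open MeasureTheory Filter
open scoped ENNReal

noncomputable section

/-- The Euclidean plane. -/
abbrev Plane : Type := EuclideanSpace ℝ (Fin 2)

/-- The closed rectangle with centre `c` whose sides of length `a` make the angle `θ` with the
first coordinate axis and whose sides of length `b` are perpendicular to these. -/
def rectangle (c : Plane) (θ a b : ℝ) : Set Plane :=
  {x | |(x 0 - c 0) * Real.cos θ + (x 1 - c 1) * Real.sin θ| ≤ a / 2 ∧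
       |(x 1 - c 1) * Real.cos θ - (x 0 - c 0) * Real.sin θ| ≤ b / 2}

/-- The family of all (nondegenerate) rectangles of the plane whose longest side makes with the
first coordinate axis an angle `θ ∈ [0, π)` with `tan θ ∈ Ω`. The vertical direction has no slope
and is excluded (Mathlib sets `Real.tan (π / 2) = 0`). -/
def rectanglesWithSlopes (Ω : Set ℝ) : Set (Set Plane) :=
  {R | ∃ (c : Plane) (θ a b : ℝ), 0 ≤ θ ∧ θ < Real.pi ∧ θ ≠ Real.pi / 2 ∧ Real.tan θ ∈ Ω ∧
    0 < b ∧ b ≤ a ∧ R = rectangle c θ a b}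

/-- The directional maximal operator: `M_Ω f (x)` is the supremum of the averages of `|f|` over
the rectangles with slope in `Ω` that contain `x`. -/
def directionalMaximal (Ω : Set ℝ) (f : Plane → ℝ) (x : Plane) : ℝ≥0∞ :=
  ⨆ (R : Set Plane) (_ : R ∈ rectanglesWithSlopes Ω) (_ : x ∈ R),
    (∫⁻ y in R, ‖f y‖ₑ) / volume R

/-- The operator norm of `M_Ω` on `L^p(ℝ²)`: the least `C ∈ [0, ∞]` such that
`‖M_Ω f‖_p ≤ C ‖f‖_p` for every `f ∈ L^p(ℝ²)`. -/
def directionalMaximalNorm (Ω : Set ℝ) (p : ℝ≥0∞) : ℝ≥0∞ :=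
  sInf {C : ℝ≥0∞ | ∀ f : Plane → ℝ, MemLp f p volume →
    eLpNorm (directionalMaximal Ω f) p volume ≤ C * eLpNorm f p volume}

/-- The Perron factor of a finite set `U = {u₀ < u₁ < ⋯ < u_{n-1}}` of reals: the supremum over
`k ≥ 0`, `l ≥ 1` with `k + 2l ≤ n - 1` of
`(u_{k+2l} - u_{k+l}) / (u_{k+l} - u_k) + (u_{k+l} - u_k) / (u_{k+2l} - u_{k+l})`. -/
def perronFactor (U : Finset ℝ) : ℝ≥0∞ :=
  ⨆ (k : ℕ) (l : ℕ) (_ : 1 ≤ l) (h : k + 2 * l < U.card),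
    let u : Fin U.card ↪o ℝ := U.orderEmbOfFin rfl
    let d₁ : ℝ := u ⟨k + l, by omega⟩ - u ⟨k, by omega⟩
    let d₂ : ℝ := u ⟨k + 2 * l, h⟩ - u ⟨k + l, by omega⟩
    ENNReal.ofReal (d₂ / d₁ + d₁ / d₂)

/-- The Perron capacity of a set of slopes: the lower limit, as `N → ∞`, of the infimum of the
Perron factors of the subsets of `Ω` with `2 ^ N` elements (`∞` if there are none). -/
def perronCapacity (Ω : Set ℝ) : ℝ≥0∞ :=
  liminf (fun N : ℕ => ⨅ (U : Finset ℝ) (_ : (U : Set ℝ) ⊆ Ω) (_ : U.card = 2 ^ N),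
    perronFactor U) atTop

end

/-! A Perron tree serves as a Kakeya-type counterexample. Take triangles with apex at the origin
between consecutive lines of slopes `u j`, `u (j + 1)`, and slide them vertically into a tree of `2
^ n` branches. Write Δ for the total increment of `u`.

To the right of the axis the branches overlap heavily: each section over `(0, n]` has length at most
a constant times Δ, so this part `K` has area O(nΔ). The constant depends only on a bound for the
Perron factors, which keeps the two halves of every dyadic block comparable
(`volume_perronSection_le`). To the left the branches are disjoint, so the reflected part `L` over
`(-n, 0]` has area n²Δ/2 (`volume_perronSection_of_nonpos`).

Each branch and its reflection fit in one rectangle with slope in Ω, of area comparable to the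
branch. Hence `M_Ω` of the indicator of `K` is at least 1/24 on `L`
(`le_directionalMaximal_perronTree`). An `L^p` bound would give |L| ≲ |K|, so n would be bounded;
finite capacity provides arbitrarily large n. -/

/-! ### Sections of Perron trees -/

/-- The vertical section at abscissa `x` of the Perron tree built over the triangles with apex on
the vertical axis and sides of slopes `u (s + j)`, `u (s + j + 1)`, `j < 2 ^ m`. To join two halves,
the upper one is moved down so that its first line meets that of the lower one at `x = m + 1`. -/
def perronSection (u : ℕ → ℝ) : ℕ → ℕ → ℝ → Set ℝ
  | 0, s, x => Set.uIoc (u s * x) (u (s + 1) * x)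
  | m + 1, s, x => perronSection u m s x ∪
      {y | y + (m + 1) * (u (s + 2 ^ m) - u s) ∈ perronSection u m (s + 2 ^ m) x}

/-- Both halves of every block of indices of dyadic length up to `M` carry at most the proportion
`ρ` of its increment. -/
def DyadicallyBalanced (u : ℕ → ℝ) (M : ℕ) (ρ : ℝ) : Prop :=
  ∀ m s, s + 2 ^ (m + 1) ≤ M →
    u (s + 2 ^ m) - u s ≤ ρ * (u (s + 2 ^ (m + 1)) - u s) ∧
    u (s + 2 ^ (m + 1)) - u (s + 2 ^ m) ≤ ρ * (u (s + 2 ^ (m + 1)) - u s)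

theorem measurableSet_perronSection_graph (u : ℕ → ℝ) (m s : ℕ) :
    MeasurableSet {q : ℝ × ℝ | q.2 ∈ perronSection u m s q.1} := by
  induction m generalizing s with
  | zero =>
    have : {q : ℝ × ℝ | q.2 ∈ perronSection u 0 s q.1} =
        {q | min (u s * q.1) (u (s + 1) * q.1) < q.2} ∩
        {q | q.2 ≤ max (u s * q.1) (u (s + 1) * q.1)} := by
      ext q; simp [perronSection, Set.uIoc]
    rw [this]
    exact (measurableSet_lt (by fun_prop) (by fun_prop)).inter
      (measurableSet_le (by fun_prop) (by fun_prop))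
  | succ m ih =>
    have hg : Measurable (fun q : ℝ × ℝ => (q.1, q.2 + (m + 1) * (u (s + 2 ^ m) - u s))) := by
      fun_prop
    exact (ih s).union (hg (ih (s + 2 ^ m)))

theorem measurableSet_perronSection (u : ℕ → ℝ) (m s : ℕ) (x : ℝ) :
    MeasurableSet (perronSection u m s x) :=
  measurable_prodMk_left (x := x) (measurableSet_perronSection_graph u m s)

theorem sub_nonneg_of_monotoneOn_Iic {u : ℕ → ℝ} {M i j : ℕ} (hu : MonotoneOn u (Set.Iic M))
    (hij : i ≤ j) (hj : j ≤ M) : 0 ≤ u j - u i :=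
  sub_nonneg.2 (hu (hij.trans hj) hj hij)

/-- To the right of its last joining abscissa the tree lies in a thin sector above its lowest line.
The affine profile `α * (x - m) + β` survives a joining step: `h₁` controls its slope and `h₂` its
constant term. -/
theorem perronSection_subset_Icc {u : ℕ → ℝ} {M : ℕ} {ρ α β : ℝ}
    (hu : MonotoneOn u (Set.Iic M)) (hb : DyadicallyBalanced u M ρ)
    (hα : 1 ≤ α) (hβ : 0 ≤ β) (h₁ : ρ * (1 + α) ≤ α) (h₂ : ρ * (α + β) ≤ β)
    (m s : ℕ) (hs : s + 2 ^ m ≤ M) {x : ℝ} (hx : m ≤ x) :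
    perronSection u m s x ⊆
      Set.Icc (u s * x) (u s * x + (u (s + 2 ^ m) - u s) * (α * (x - m) + β)) := by
  induction m generalizing s with
  | zero =>
    have hx0 : 0 ≤ x := by simpa using hx
    have hle : u s ≤ u (s + 1) := hu (by simp at hs ⊢; omega) (by simpa using hs) (by omega)
    intro y hy
    rw [perronSection, Set.uIoc_of_le (by gcongr)] at hy
    refine ⟨hy.1.le, hy.2.trans ?_⟩
    simp only [pow_zero, Nat.cast_zero, sub_zero]
    have : (u (s + 1) - u s) * x ≤ (u (s + 1) - u s) * (α * x + β) :=
      mul_le_mul_of_nonneg_left (by nlinarith) (by linarith)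
    linarith
  | succ m ih =>
    have e : s + 2 ^ (m + 1) = s + 2 ^ m + 2 ^ m := by ring
    have hpow : 0 < 2 ^ m := Nat.two_pow_pos m
    obtain ⟨hl, hr⟩ := hb m s hs
    rw [e] at hs hl hr ⊢
    have h0 : 0 ≤ u (s + 2 ^ m) - u s :=
      sub_nonneg_of_monotoneOn_Iic hu (by omega) (by omega)
    have h1 : 0 ≤ u (s + 2 ^ m + 2 ^ m) - u (s + 2 ^ m) :=
      sub_nonneg_of_monotoneOn_Iic hu (by omega) (by omega)
    push_cast at hx ⊢
    have hL := ih s (by omega) (by linarith)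
    have hR := ih (s + 2 ^ m) hs (by linarith)
    set L := u (s + 2 ^ m) - u s with hLdef
    set R := u (s + 2 ^ m + 2 ^ m) - u (s + 2 ^ m) with hRdef
    have hD : u (s + 2 ^ m + 2 ^ m) - u s = L + R := by rw [hLdef, hRdef]; ring
    rw [hD] at hl hr ⊢
    have hy0 : 0 ≤ x - (m + 1) := by linarith
    set t := x - (m + 1) with ht
    have hxm : x - m = t + 1 := by rw [ht]; ring
    rw [hxm] at hL hR
    have hpos : 0 ≤ α * (t + 1) + β := by nlinarith
    -- Both sides are affine in `t ≥ 0`; the coefficients of `t` compare by `h₁`, the constant terms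
    -- by `h₂`.
    have key : ρ * (L + R) * (t + (α * (t + 1) + β)) ≤ (L + R) * (α * t + β) := by
      have : ρ * (t + (α * (t + 1) + β)) ≤ α * t + β := by nlinarith
      nlinarith
    rintro y (hy | hy)
    · obtain ⟨hy1, hy2⟩ := hL hy
      refine ⟨hy1, hy2.trans ?_⟩
      have : L * (α * (t + 1) + β) ≤ ρ * (L + R) * (t + (α * (t + 1) + β)) :=
        mul_le_mul hl (by linarith) hpos (by linarith)
      linarith
    · obtain ⟨hy1, hy2⟩ := hR hy
      have hLx : u (s + 2 ^ m) * x - (m + 1) * L = u s * x + L * t := by rw [ht, hLdef]; ring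
      have h3 : 0 ≤ L * t := mul_nonneg h0 hy0
      refine ⟨by linarith, ?_⟩
      have h4 : L * t ≤ ρ * (L + R) * t := mul_le_mul_of_nonneg_right hl hy0
      have h5 : R * (α * (t + 1) + β) ≤ ρ * (L + R) * (α * (t + 1) + β) :=
        mul_le_mul_of_nonneg_right hr hpos
      linarith

/-- For `m ≤ x ≤ m + 1` the sector bound applies. For smaller `x`, split the tree into halves until
the level fits `x`; the bounds add up because the increments do. -/
theorem volume_perronSection_le {u : ℕ → ℝ} {M : ℕ} {ρ α β : ℝ}
    (hu : MonotoneOn u (Set.Iic M)) (hb : DyadicallyBalanced u M ρ)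
    (hα : 1 ≤ α) (hβ : 0 ≤ β) (h₁ : ρ * (1 + α) ≤ α) (h₂ : ρ * (α + β) ≤ β)
    (m s : ℕ) (hs : s + 2 ^ m ≤ M) {x : ℝ} (hx0 : 0 ≤ x) (hx : x ≤ m + 1) :
    volume (perronSection u m s x) ≤ ENNReal.ofReal ((α + β) * (u (s + 2 ^ m) - u s)) := by
  have top (m s : ℕ) (hs : s + 2 ^ m ≤ M) (hmx : m ≤ x) (hx : x ≤ m + 1) :
      volume (perronSection u m s x) ≤ ENNReal.ofReal ((α + β) * (u (s + 2 ^ m) - u s)) := by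
    refine (measure_mono (perronSection_subset_Icc hu hb hα hβ h₁ h₂ m s hs hmx)).trans ?_
    rw [Real.volume_Icc]
    refine ENNReal.ofReal_le_ofReal ?_
    have h0 : 0 ≤ u (s + 2 ^ m) - u s :=
      sub_nonneg_of_monotoneOn_Iic hu (Nat.le_add_right _ _) hs
    have : (u (s + 2 ^ m) - u s) * (α * (x - m) + β) ≤ (u (s + 2 ^ m) - u s) * (α + β) :=
      mul_le_mul_of_nonneg_left (by nlinarith) h0
    linarith
  induction m generalizing s with
  | zero => exact top 0 s hs (by simpa using hx0) hx
  | succ m ih =>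
    rcases le_or_gt ((m + 1 : ℕ) : ℝ) x with h | h
    · exact top (m + 1) s hs h hx
    · push_cast at h
      have e : s + 2 ^ (m + 1) = s + 2 ^ m + 2 ^ m := by ring
      have hpow : 0 < 2 ^ m := Nat.two_pow_pos m
      rw [e] at hs ⊢
      have h0 : 0 ≤ u (s + 2 ^ m) - u s :=
        sub_nonneg_of_monotoneOn_Iic hu (by omega) (by omega)
      have h1 : 0 ≤ u (s + 2 ^ m + 2 ^ m) - u (s + 2 ^ m) :=
        sub_nonneg_of_monotoneOn_Iic hu (by omega) (by omega)
      have hA : 0 ≤ α + β := by linarith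
      calc volume (perronSection u (m + 1) s x)
          ≤ volume (perronSection u m s x) + volume ((· + (m + 1) * (u (s + 2 ^ m) - u s)) ⁻¹'
              perronSection u m (s + 2 ^ m) x) := measure_union_le _ _
        _ = volume (perronSection u m s x) + volume (perronSection u m (s + 2 ^ m) x) := by
          rw [measure_preimage_add_right]
        _ ≤ _ := add_le_add (ih s (by omega) h.le) (ih (s + 2 ^ m) hs h.le)
        _ = _ := by
          rw [← ENNReal.ofReal_add (by positivity) (by positivity)]; congr 1; ring

/-- Left of the axis, a tree of level `m` has sunk by at most `m` times its increment below its
untranslated sector. The next joining shift uses the factor `m + 1`, which keeps the two halves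
disjoint there. -/
theorem perronSection_subset_Ioc {u : ℕ → ℝ} {M : ℕ} (hu : MonotoneOn u (Set.Iic M))
    (m s : ℕ) (hs : s + 2 ^ m ≤ M) {x : ℝ} (hx : x ≤ 0) :
    perronSection u m s x ⊆
      Set.Ioc (u s * x + (u (s + 2 ^ m) - u s) * (x - m)) (u s * x) := by
  induction m generalizing s with
  | zero =>
    have hle : u s ≤ u (s + 1) := hu (by simp at hs ⊢; omega) (by simpa using hs) (by omega)
    intro y hy
    rw [perronSection, Set.uIoc_of_ge (mul_le_mul_of_nonpos_right hle hx)] at hy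
    refine ⟨?_, hy.2⟩
    simp only [pow_zero, Nat.cast_zero, sub_zero]
    linarith [hy.1]
  | succ m ih =>
    have e : s + 2 ^ (m + 1) = s + 2 ^ m + 2 ^ m := by ring
    have hpow : 0 < 2 ^ m := Nat.two_pow_pos m
    rw [e] at hs ⊢
    have h0 : 0 ≤ u (s + 2 ^ m) - u s :=
      sub_nonneg_of_monotoneOn_Iic hu (by omega) (by omega)
    have h1 : 0 ≤ u (s + 2 ^ m + 2 ^ m) - u (s + 2 ^ m) :=
      sub_nonneg_of_monotoneOn_Iic hu (by omega) (by omega)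
    have hm : (0 : ℝ) ≤ m := m.cast_nonneg
    push_cast
    rintro y (hy | hy)
    · obtain ⟨hy1, hy2⟩ := ih s (by omega) hy
      exact ⟨by nlinarith, hy2⟩
    · obtain ⟨hy1, hy2⟩ := ih (s + 2 ^ m) hs hy
      exact ⟨by nlinarith, by nlinarith⟩

theorem volume_perronSection_of_nonpos {u : ℕ → ℝ} {M : ℕ} (hu : MonotoneOn u (Set.Iic M))
    (m s : ℕ) (hs : s + 2 ^ m ≤ M) {x : ℝ} (hx : x ≤ 0) :
    volume (perronSection u m s x) = ENNReal.ofReal ((u (s + 2 ^ m) - u s) * -x) := by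
  induction m generalizing s with
  | zero =>
    have hle : u s ≤ u (s + 1) := hu (by simp at hs ⊢; omega) (by simpa using hs) (by omega)
    rw [perronSection, Set.uIoc_of_ge (mul_le_mul_of_nonpos_right hle hx), Real.volume_Ioc]
    congr 1
    simp only [pow_zero]
    ring
  | succ m ih =>
    have e : s + 2 ^ (m + 1) = s + 2 ^ m + 2 ^ m := by ring
    have hpow : 0 < 2 ^ m := Nat.two_pow_pos m
    rw [e] at hs ⊢
    have h0 : 0 ≤ u (s + 2 ^ m) - u s :=
      sub_nonneg_of_monotoneOn_Iic hu (by omega) (by omega)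
    have h1 : 0 ≤ u (s + 2 ^ m + 2 ^ m) - u (s + 2 ^ m) :=
      sub_nonneg_of_monotoneOn_Iic hu (by omega) (by omega)
    have hx' : 0 ≤ -x := by linarith
    have hd : Disjoint (perronSection u m s x)
        ((· + (m + 1) * (u (s + 2 ^ m) - u s)) ⁻¹' perronSection u m (s + 2 ^ m) x) := by
      rw [Set.disjoint_left]
      intro y hy hy'
      have a := (perronSection_subset_Ioc hu m s (by omega) hx hy).1
      have b := (perronSection_subset_Ioc hu m (s + 2 ^ m) hs hx hy').2
      nlinarith
    calc volume (perronSection u (m + 1) s x)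
        = volume (perronSection u m s x) + volume ((· + (m + 1) * (u (s + 2 ^ m) - u s)) ⁻¹'
            perronSection u m (s + 2 ^ m) x) :=
          measure_union hd ((measurableSet_perronSection u m (s + 2 ^ m) x).preimage (by fun_prop))
      _ = _ := by
        rw [measure_preimage_add_right, ih s (by omega), ih (s + 2 ^ m) hs,
          ← ENNReal.ofReal_add (by positivity) (by positivity)]
        congr 1; ring

/-- A Perron tree is a union of vertically translated triangles. -/
theorem exists_triangle_of_mem_perronSection {u : ℕ → ℝ} {m s : ℕ} {x y : ℝ}
    (h : y ∈ perronSection u m s x) :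
    ∃ j b, s ≤ j ∧ j < s + 2 ^ m ∧ y + b ∈ Set.uIoc (u j * x) (u (j + 1) * x) ∧
      ∀ x' y', y' + b ∈ Set.uIoc (u j * x') (u (j + 1) * x') → y' ∈ perronSection u m s x' := by
  induction m generalizing s y with
  | zero =>
    exact ⟨s, 0, le_rfl, by simp, by simpa [perronSection] using h,
      fun x' y' h' => by simpa [perronSection] using h'⟩
  | succ m ih =>
    have e : s + 2 ^ (m + 1) = s + 2 ^ m + 2 ^ m := by ring
    have hpow : 0 < 2 ^ m := Nat.two_pow_pos m
    rw [e]
    rcases h with h | h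
    · obtain ⟨j, b, h1, h2, h3, h4⟩ := ih h
      exact ⟨j, b, h1, by omega, h3, fun x' y' h' => Or.inl (h4 x' y' h')⟩
    · obtain ⟨j, b, h1, h2, h3, h4⟩ := ih h
      refine ⟨j, (m + 1) * (u (s + 2 ^ m) - u s) + b, by omega, h2, by rwa [← add_assoc],
        fun x' y' h' => Or.inr (h4 x' _ ?_)⟩
      rwa [add_assoc]

/-! ### Areas of plane regions and rectangles -/

theorem volume_preserving_plane_coordinates :
    MeasurePreserving (fun p : Plane => (p 0, p 1)) volume volume :=
  (volume_preserving_finTwoArrow ℝ).comp (PiLp.volume_preserving_ofLp (Fin 2))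

theorem measurableSet_region {I : Set ℝ} (hI : MeasurableSet I) {S : ℝ → Set ℝ}
    (hS : MeasurableSet {q : ℝ × ℝ | q.2 ∈ S q.1}) :
    MeasurableSet {p : Plane | p 0 ∈ I ∧ p 1 ∈ S (p 0)} :=
  volume_preserving_plane_coordinates.measurable ((measurable_fst hI).inter hS)

theorem volume_region {I : Set ℝ} (hI : MeasurableSet I) {S : ℝ → Set ℝ}
    (hS : MeasurableSet {q : ℝ × ℝ | q.2 ∈ S q.1}) :
    volume {p : Plane | p 0 ∈ I ∧ p 1 ∈ S (p 0)} = ∫⁻ x in I, volume (S x) := by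
  have hm : MeasurableSet {q : ℝ × ℝ | q.1 ∈ I ∧ q.2 ∈ S q.1} := (measurable_fst hI).inter hS
  have := volume_preserving_plane_coordinates.measure_preimage hm.nullMeasurableSet
  refine Eq.trans this ?_
  rw [Measure.volume_eq_prod, Measure.prod_apply hm, ← lintegral_indicator hI]
  refine lintegral_congr fun x => ?_
  by_cases hx : x ∈ I <;> simp [hx]

theorem volume_rectangle_le (c : Plane) (θ : ℝ) {a b : ℝ} (ha : 0 ≤ a) :
    volume (rectangle c θ a b) ≤ ENNReal.ofReal (a * b) := by
  let A : Matrix (Fin 2) (Fin 2) ℝ := !![Real.cos θ, Real.sin θ; -Real.sin θ, Real.cos θ]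
  have hdet : LinearMap.det (Matrix.toLin' A) = 1 := by
    rw [LinearMap.det_toLin', Matrix.det_fin_two_of]
    nlinarith [Real.sin_sq_add_cos_sq θ]
  let B : Set (Fin 2 → ℝ) := Set.Icc ![-(a / 2), -(b / 2)] ![a / 2, b / 2]
  have hR : rectangle c θ a b =
      WithLp.ofLp ⁻¹' ((· - WithLp.ofLp c) ⁻¹' (Matrix.toLin' A ⁻¹' B)) := by
    ext x
    simp only [rectangle, Set.mem_ofPred_eq, Set.mem_preimage, B, Set.mem_Icc, Pi.le_def,
      Fin.forall_fin_two, Matrix.toLin'_apply, A, Matrix.mulVec, dotProduct, Fin.sum_univ_two,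
      abs_le]
    simp
    constructor
    · rintro ⟨⟨h1, h2⟩, h3, h4⟩
      refine ⟨⟨?_, ?_⟩, ?_, ?_⟩ <;> linarith
    · rintro ⟨⟨h1, h2⟩, h3, h4⟩
      refine ⟨⟨?_, ?_⟩, ?_, ?_⟩ <;> linarith
  have hB : MeasurableSet B := measurableSet_Icc
  have hA : Measurable (Matrix.toLin' A) :=
    (LinearMap.continuous_of_finiteDimensional _).measurable
  have hm : MeasurableSet ((· - WithLp.ofLp c) ⁻¹' (Matrix.toLin' A ⁻¹' B)) :=
    (hA hB).preimage (by fun_prop)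
  rw [hR, (PiLp.volume_preserving_ofLp (Fin 2)).measure_preimage hm.nullMeasurableSet]
  have : volume ((· - WithLp.ofLp c) ⁻¹' (Matrix.toLin' A ⁻¹' B)) =
      volume (Matrix.toLin' A ⁻¹' B) :=
    (measurePreserving_sub_right volume _).measure_preimage (hA hB).nullMeasurableSet
  rw [this, Measure.addHaar_preimage_linearMap _ (by rw [hdet]; exact one_ne_zero), hdet]
  simp only [B, Real.volume_Icc_pi, Fin.prod_univ_two]
  simp only [inv_one, abs_one, ENNReal.ofReal_one, one_mul, Matrix.cons_val_zero,
    Matrix.cons_val_one]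
  rw [← ENNReal.ofReal_mul (by linarith)]
  exact ENNReal.ofReal_le_ofReal (by nlinarith)

theorem rectangle_add_pi (c : Plane) (θ a b : ℝ) :
    rectangle c (θ + Real.pi) a b = rectangle c θ a b := by
  ext x
  simp only [rectangle, Set.mem_ofPred_eq, Real.cos_add_pi, Real.sin_add_pi]
  rw [← abs_neg ((x 0 - c 0) * Real.cos θ + (x 1 - c 1) * Real.sin θ),
    ← abs_neg ((x 1 - c 1) * Real.cos θ - (x 0 - c 0) * Real.sin θ)]
  ring_nf

theorem rectangle_arctan_mem {Ω : Set ℝ} {v : ℝ} (hv : v ∈ Ω) (c : Plane) {a b : ℝ} (hb : 0 < b)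
    (hab : b ≤ a) : rectangle c (Real.arctan v) a b ∈ rectanglesWithSlopes Ω := by
  have h1 := Real.neg_pi_div_two_lt_arctan v
  have h2 := Real.arctan_lt_pi_div_two v
  have h3 := Real.pi_pos
  rcases le_or_gt 0 v with h | h
  · exact ⟨c, Real.arctan v, a, b, Real.arctan_nonneg.2 h, by linarith, by linarith,
      by rwa [Real.tan_arctan], hb, hab, rfl⟩
  · have := Real.arctan_lt_zero.2 h
    -- A negative slope has negative arctangent; adding π brings the angle into `[0, π)` without
    -- changing the rectangle.
    exact ⟨c, Real.arctan v + Real.pi, a, b, by linarith, by linarith, by linarith,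
      by rwa [Real.tan_add_pi, Real.tan_arctan], hb, hab, (rectangle_add_pi _ _ _ _).symm⟩

/-- A parallelogram with two vertical sides that are not long compared with its slope is contained
in a rectangle of the same slope whose area is at most three times as large. -/
theorem mem_rectangle_arctan {v r w b : ℝ} (hr : 0 ≤ r) (hw : w ≤ 2 * r * |v|) {p : Plane}
    (hp0 : |p 0| ≤ r) (hp1 : |p 1 - v * p 0 - b| ≤ w) :
    p ∈ rectangle !₂[0, b] (Real.arctan v) (6 * r * √(1 + v ^ 2)) (2 * w / √(1 + v ^ 2)) := by
  have hs : 0 < √(1 + v ^ 2) := Real.sqrt_pos.2 (by positivity)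
  have hs2 : √(1 + v ^ 2) ^ 2 = 1 + v ^ 2 := Real.sq_sqrt (by positivity)
  simp only [rectangle, Set.mem_ofPred_eq, Real.cos_arctan, Real.sin_arctan]
  set s := √(1 + v ^ 2)
  set t := p 1 - v * p 0 - b with ht
  have e1 : p 1 = v * p 0 + b + t := by rw [ht]; ring
  rw [e1, Matrix.cons_val_zero, Matrix.cons_val_one, Matrix.cons_val_zero]
  constructor
  · have : (p 0 - 0) * (1 / s) + (v * p 0 + b + t - b) * (v / s) = p 0 * s + v * t / s := by
      field_simp
      rw [hs2]; ring
    rw [this]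
    have h1 : |p 0 * s| ≤ r * s := by
      rw [abs_mul, abs_of_pos hs]; gcongr
    -- The vertical deviation `t` shifts the long coordinate by at most `2 * r * v ^ 2 / s`.
    -- Together with `r * s` this gives the half-length `3 * r * s`.
    have h2 : |v * t / s| ≤ 2 * r * s := by
      rw [abs_div, abs_of_pos hs, div_le_iff₀ hs, abs_mul]
      have : |v| * |t| ≤ |v| * (2 * r * |v|) := by gcongr; linarith
      nlinarith [sq_abs v]
    calc _ ≤ |p 0 * s| + |v * t / s| := abs_add_le _ _
      _ ≤ _ := by linarith
  · have : (v * p 0 + b + t - b) * (1 / s) - (p 0 - 0) * (v / s) = t / s := by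
      field_simp; ring
    rw [this, abs_div, abs_of_pos hs]
    have : 2 * w / s / 2 = w / s := by ring
    rw [this]
    gcongr

theorem le_directionalMaximal_indicator {Ω : Set ℝ} {R K : Set Plane} {x : Plane}
    (hR : R ∈ rectanglesWithSlopes Ω) (hx : x ∈ R) (hK : MeasurableSet K) :
    volume (K ∩ R) / volume R ≤ directionalMaximal Ω (K.indicator 1) x := by
  refine le_iSup₂_of_le R hR (le_iSup_of_le hx ?_)
  gcongr
  have (y : Plane) : ‖K.indicator (1 : Plane → ℝ) y‖ₑ = K.indicator 1 y := by
    by_cases hy : y ∈ K <;> simp [hy]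
  simp only [this]
  rw [lintegral_indicator_one hK, Measure.restrict_apply hK]

theorem abs_sub_le_of_mem_uIoc {a c y : ℝ} (h : y ∈ Set.uIoc a c) :
    |y - a| ≤ |c - a| ∧ |y - c| ≤ |c - a| := by
  have h' := Set.uIoc_subset_uIcc h
  exact ⟨Set.abs_sub_left_of_mem_uIcc h', by
    rw [abs_sub_comm y c]; exact Set.abs_sub_right_of_mem_uIcc h'⟩

theorem lintegral_Ioc_ofReal_mul {d r : ℝ} (hd : 0 ≤ d) (hr : 0 ≤ r) :
    ∫⁻ x in Set.Ioc 0 r, ENNReal.ofReal (d * x) = ENNReal.ofReal (d * r ^ 2 / 2) := by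
  rw [← ofReal_integral_eq_lintegral_ofReal, ← intervalIntegral.integral_of_le hr,
    intervalIntegral.integral_const_mul, integral_id]
  · congr 1; ring
  · exact (Continuous.integrableOn_Icc (by fun_prop)).mono_set Set.Ioc_subset_Icc_self
  · exact (ae_restrict_mem measurableSet_Ioc).mono fun x hx => mul_nonneg hd hx.1.le

theorem lintegral_Ioc_ofReal_mul_neg {d r : ℝ} (hd : 0 ≤ d) (hr : 0 ≤ r) :
    ∫⁻ x in Set.Ioc (-r) 0, ENNReal.ofReal (d * -x) = ENNReal.ofReal (d * r ^ 2 / 2) := by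
  rw [← ofReal_integral_eq_lintegral_ofReal, ← intervalIntegral.integral_of_le (by linarith),
    intervalIntegral.integral_const_mul, intervalIntegral.integral_neg, integral_id]
  · congr 1; ring
  · exact (Continuous.integrableOn_Icc (by fun_prop)).mono_set Set.Ioc_subset_Icc_self
  · exact (ae_restrict_mem measurableSet_Ioc).mono fun x hx =>
      mul_nonneg hd (by linarith [hx.2])

/-! ### Perron trees and the maximal function -/

/-- The part over the abscissas in `I` of the Perron tree with `2 ^ n` branches. -/
def perronTree (u : ℕ → ℝ) (n : ℕ) (I : Set ℝ) : Set Plane :=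
  {p | p 0 ∈ I ∧ p 1 ∈ perronSection u n 0 (p 0)}

theorem measurableSet_perronTree (u : ℕ → ℝ) (n : ℕ) {I : Set ℝ} (hI : MeasurableSet I) :
    MeasurableSet (perronTree u n I) :=
  measurableSet_region hI (measurableSet_perronSection_graph u n 0)

theorem volume_perronTree_le {u : ℕ → ℝ} {n : ℕ} {ρ α β : ℝ}
    (hu : MonotoneOn u (Set.Iic (2 ^ n))) (hb : DyadicallyBalanced u (2 ^ n) ρ)
    (hα : 1 ≤ α) (hβ : 0 ≤ β) (h₁ : ρ * (1 + α) ≤ α) (h₂ : ρ * (α + β) ≤ β) :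
    volume (perronTree u n (Set.Ioc 0 n)) ≤
      ENNReal.ofReal ((α + β) * (u (2 ^ n) - u 0) * n) := by
  have hΔ := sub_nonneg_of_monotoneOn_Iic hu (Nat.zero_le _) le_rfl
  rw [perronTree, volume_region measurableSet_Ioc (measurableSet_perronSection_graph u n 0)]
  calc ∫⁻ x in Set.Ioc (0 : ℝ) n, volume (perronSection u n 0 x)
      ≤ ∫⁻ _ in Set.Ioc (0 : ℝ) n, ENNReal.ofReal ((α + β) * (u (2 ^ n) - u 0)) := by
        refine setLIntegral_mono measurable_const fun x hx => ?_
        simpa using volume_perronSection_le hu hb hα hβ h₁ h₂ n 0 (by simp) hx.1.le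
          (by linarith [hx.2])
    _ = _ := by
        rw [setLIntegral_const, Real.volume_Ioc, sub_zero, ← ENNReal.ofReal_mul]
        exact mul_nonneg (by linarith) hΔ

theorem volume_perronTree_reflected {u : ℕ → ℝ} {n : ℕ} (hu : MonotoneOn u (Set.Iic (2 ^ n))) :
    volume (perronTree u n (Set.Ioc (-n) 0)) =
      ENNReal.ofReal ((u (2 ^ n) - u 0) * n ^ 2 / 2) := by
  have hΔ := sub_nonneg_of_monotoneOn_Iic hu (Nat.zero_le _) le_rfl
  rw [perronTree, volume_region measurableSet_Ioc (measurableSet_perronSection_graph u n 0),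
    ← lintegral_Ioc_ofReal_mul_neg hΔ n.cast_nonneg]
  refine setLIntegral_congr_fun measurableSet_Ioc fun x hx => ?_
  simpa using volume_perronSection_of_nonpos hu n 0 (by simp) hx.2

theorem le_directionalMaximal_perronTree {Ω : Set ℝ} {u : ℕ → ℝ} {n : ℕ} (hn : 0 < n)
    (hu : StrictMonoOn u (Set.Iic (2 ^ n))) (hΩ : ∀ i ≤ 2 ^ n, u i ∈ Ω) {p : Plane}
    (hp : p ∈ perronTree u n (Set.Ioc (-n) 0)) :
    ENNReal.ofReal (1 / 24) ≤
      directionalMaximal Ω ((perronTree u n (Set.Ioc 0 n)).indicator 1) p := by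
  obtain ⟨hp0, hp1⟩ := hp
  obtain ⟨j, b, -, hj, hpj, htri⟩ := exists_triangle_of_mem_perronSection hp1
  rw [zero_add] at hj
  have hn' : (0 : ℝ) < n := by exact_mod_cast hn
  have hδ : 0 < u (j + 1) - u j := sub_pos.2 (hu hj.le hj (Nat.lt_succ_self j))
  set δ := u (j + 1) - u j with hδdef
  have dist (q : Plane) (hq0 : |q 0| ≤ n)
      (hq : q 1 + b ∈ Set.uIoc (u j * q 0) (u (j + 1) * q 0)) :
      |q 1 - u j * q 0 - -b| ≤ n * δ ∧ |q 1 - u (j + 1) * q 0 - -b| ≤ n * δ := by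
    have h := abs_sub_le_of_mem_uIoc hq
    rw [← sub_mul, abs_mul, abs_of_pos hδ] at h
    have h' : δ * |q 0| ≤ n * δ := by rw [mul_comm]; gcongr
    refine ⟨le_trans (le_of_eq ?_) (h.1.trans h'), le_trans (le_of_eq ?_) (h.2.trans h')⟩ <;>
    · congr 1; ring
  -- The steeper of the two bounding lines supplies the slope: since `δ ≤ |u j| + |u (j + 1)|`, it
  -- satisfies `δ ≤ 2 * |v|`, even if the other line is horizontal.
  obtain ⟨v, hvΩ, hv, hvdist⟩ : ∃ v ∈ Ω, δ ≤ 2 * |v| ∧ ∀ q : Plane, |q 0| ≤ n →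
      q 1 + b ∈ Set.uIoc (u j * q 0) (u (j + 1) * q 0) → |q 1 - v * q 0 - -b| ≤ n * δ := by
    have : δ ≤ |u (j + 1)| + |u j| := (le_abs_self _).trans (abs_sub _ _)
    rcases le_total |u j| |u (j + 1)| with h | h
    · exact ⟨u (j + 1), hΩ _ hj, by linarith, fun q h0 h1 => (dist q h0 h1).2⟩
    · exact ⟨u j, hΩ _ hj.le, by linarith, fun q h0 h1 => (dist q h0 h1).1⟩
  have hs1 : 1 ≤ √(1 + v ^ 2) := Real.one_le_sqrt.2 (by nlinarith)
  have hs2 : √(1 + v ^ 2) ^ 2 = 1 + v ^ 2 := Real.sq_sqrt (by positivity)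
  set R := rectangle !₂[0, -b] (Real.arctan v) (6 * n * √(1 + v ^ 2))
    (2 * (n * δ) / √(1 + v ^ 2)) with hRdef
  have hmem (q : Plane) (hq0 : |q 0| ≤ n)
      (hq : q 1 + b ∈ Set.uIoc (u j * q 0) (u (j + 1) * q 0)) : q ∈ R :=
    mem_rectangle_arctan hn'.le (by nlinarith) hq0 (hvdist q hq0 hq)
  have hR : R ∈ rectanglesWithSlopes Ω := by
    refine rectangle_arctan_mem hvΩ _ (by positivity) ?_
    rw [div_le_iff₀ (by positivity)]
    have : |v| ≤ 1 + v ^ 2 := by nlinarith [sq_abs v, sq_nonneg (|v| - 1)]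
    have : n * δ ≤ n * (2 * (1 + v ^ 2)) := by gcongr; linarith
    nlinarith
  have hvolR : volume R ≤ ENNReal.ofReal (12 * n ^ 2 * δ) := by
    refine (volume_rectangle_le _ _ (by positivity)).trans (ENNReal.ofReal_le_ofReal (le_of_eq ?_))
    field_simp
    ring
  -- The right-hand part of the branch through `p` lies in both the tree and `R`.
  have hT : ENNReal.ofReal (δ * n ^ 2 / 2) ≤ volume (perronTree u n (Set.Ioc 0 n) ∩ R) := by
    have hmeas : MeasurableSet {q : ℝ × ℝ | q.2 ∈
        (· + b) ⁻¹' Set.uIoc (u j * q.1) (u (j + 1) * q.1)} :=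
      (measurableSet_perronSection_graph u 0 j).preimage
        (f := fun q : ℝ × ℝ => (q.1, q.2 + b)) (by fun_prop)
    have hvol : volume {q : Plane | q 0 ∈ Set.Ioc (0 : ℝ) n ∧
        q 1 ∈ (· + b) ⁻¹' Set.uIoc (u j * q 0) (u (j + 1) * q 0)} =
        ENNReal.ofReal (δ * n ^ 2 / 2) := by
      rw [volume_region (S := fun x => (· + b) ⁻¹' Set.uIoc (u j * x) (u (j + 1) * x))
        measurableSet_Ioc hmeas, ← lintegral_Ioc_ofReal_mul hδ.le hn'.le]
      refine setLIntegral_congr_fun measurableSet_Ioc fun x hx => ?_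
      rw [measure_preimage_add_right, Set.uIoc_of_le (by nlinarith [hx.1]), Real.volume_Ioc,
        ← sub_mul]
    rw [← hvol]
    refine measure_mono fun q hq => ⟨⟨hq.1, htri _ _ hq.2⟩, hmem q ?_ hq.2⟩
    rw [abs_of_pos hq.1.1]
    exact hq.1.2
  have hpR : p ∈ R := hmem p (by rw [abs_of_nonpos hp0.2]; linarith [hp0.1]) hpj
  refine le_trans ?_ (le_directionalMaximal_indicator hR hpR
    (measurableSet_perronTree u n measurableSet_Ioc))
  calc ENNReal.ofReal (1 / 24)
      = ENNReal.ofReal (δ * n ^ 2 / 2) / ENNReal.ofReal (12 * n ^ 2 * δ) := by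
        rw [← ENNReal.ofReal_div_of_pos (by positivity)]
        congr 1
        field_simp
        norm_num
    _ ≤ _ := ENNReal.div_le_div hT hvolR

/-! ### From finite capacity to an unbounded norm -/

/-- A weak type consequence of a bound for `M_Ω` on `L^p`. -/
theorem volume_le_of_le_directionalMaximal {Ω : Set ℝ} {p C : ℝ≥0∞} (hp₀ : p ≠ 0) (hp : p ≠ ∞)
    (hC : ∀ f : Plane → ℝ, MemLp f p volume →
      eLpNorm (directionalMaximal Ω f) p volume ≤ C * eLpNorm f p volume)
    {K L : Set Plane} (hK : MeasurableSet K) (hL : MeasurableSet L) (hKfin : volume K ≠ ∞)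
    {c : ℝ≥0∞} (hc : ∀ x ∈ L, c ≤ directionalMaximal Ω (K.indicator 1) x) :
    c ^ p.toReal * volume L ≤ C ^ p.toReal * volume K := by
  have hp' : 0 < p.toReal := ENNReal.toReal_pos hp₀ hp
  have h1 : eLpNorm (L.indicator fun _ => c) p volume ≤
      eLpNorm (directionalMaximal Ω (K.indicator 1)) p volume := by
    refine eLpNorm_mono_enorm fun x => ?_
    by_cases hx : x ∈ L
    · simpa [hx] using hc x hx
    · simp [hx]
  have h2 := h1.trans (hC _ (memLp_indicator_const p hK 1 (Or.inr hKfin)))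
  have h3 : eLpNorm (K.indicator (1 : Plane → ℝ)) p volume = volume K ^ (1 / p.toReal) := by
    refine (eLpNorm_indicator_const (c := (1 : ℝ)) hK hp₀ hp).trans ?_
    rw [enorm_one, one_mul]
  rw [h3, eLpNorm_indicator_const hL hp₀ hp] at h2
  have h4 := ENNReal.rpow_le_rpow h2 hp'.le
  rwa [ENNReal.mul_rpow_of_nonneg _ _ hp'.le, ENNReal.mul_rpow_of_nonneg _ _ hp'.le,
    ← ENNReal.rpow_mul, ← ENNReal.rpow_mul, one_div_mul_cancel hp'.ne', ENNReal.rpow_one,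
    ENNReal.rpow_one] at h4

/-- Both ratios are positive, so each is at most `G`; and `a ≤ G * d` is the same as `a ≤ G / (1 +
G) * (a + d)`. -/
theorem dyadicallyBalanced_of_ratio_le {u : ℕ → ℝ} {M : ℕ} {G : ℝ}
    (hu : StrictMonoOn u (Set.Iic M))
    (h : ∀ k l, 1 ≤ l → k + 2 * l ≤ M →
      (u (k + 2 * l) - u (k + l)) / (u (k + l) - u k) +
        (u (k + l) - u k) / (u (k + 2 * l) - u (k + l)) ≤ G) :
    DyadicallyBalanced u M (G / (1 + G)) := by
  intro m s hs
  have e : s + 2 ^ (m + 1) = s + 2 * 2 ^ m := by ring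
  have hpow : 0 < 2 ^ m := Nat.two_pow_pos m
  rw [e] at hs ⊢
  have hr := h s (2 ^ m) hpow hs
  have h1 : 0 < u (s + 2 ^ m) - u s :=
    sub_pos.2 (hu (by simp; omega) (by simp; omega) (by omega))
  have h2 : 0 < u (s + 2 * 2 ^ m) - u (s + 2 ^ m) :=
    sub_pos.2 (hu (by simp; omega) (by simp; omega) (by omega))
  have hD : u (s + 2 * 2 ^ m) - u s =
    (u (s + 2 ^ m) - u s) + (u (s + 2 * 2 ^ m) - u (s + 2 ^ m)) := by ring
  rw [hD]
  set a := u (s + 2 ^ m) - u s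
  set d := u (s + 2 * 2 ^ m) - u (s + 2 ^ m)
  have p1 : 0 < d / a := div_pos h2 h1
  have p2 : 0 < a / d := div_pos h1 h2
  have q1 : d ≤ G * a := (div_le_iff₀ h1).1 (by linarith)
  have q2 : a ≤ G * d := (div_le_iff₀ h2).1 (by linarith)
  constructor <;> rw [div_mul_eq_mul_div, le_div_iff₀ (by linarith)] <;> nlinarith

/-- A bound for `M_Ω` on `L^p` bounds the size of the Perron trees with slopes in `Ω`. -/
theorem branching_le_of_directionalMaximal_bounded {Ω : Set ℝ} {p C : ℝ≥0∞} (hp₀ : p ≠ 0)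
    (hp : p ≠ ∞) (hCfin : C ≠ ∞)
    (hC : ∀ f : Plane → ℝ, MemLp f p volume →
      eLpNorm (directionalMaximal Ω f) p volume ≤ C * eLpNorm f p volume)
    {u : ℕ → ℝ} {n : ℕ} {G : ℝ} (hG : 0 ≤ G) (hu : StrictMonoOn u (Set.Iic (2 ^ n)))
    (hΩ : ∀ i ≤ 2 ^ n, u i ∈ Ω) (hb : DyadicallyBalanced u (2 ^ n) (G / (1 + G))) :
    (1 / 24) ^ p.toReal * n ≤ 2 * C.toReal ^ p.toReal * (G + 1) ^ 2 := by
  rcases n.eq_zero_or_pos with rfl | hn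
  · simp only [Nat.cast_zero, mul_zero]; positivity
  have hn' : (0 : ℝ) < n := by exact_mod_cast hn
  have hΔ : 0 < u (2 ^ n) - u 0 := sub_pos.2 (hu (by simp) (by simp) (by simp))
  have hG1 : (0 : ℝ) < 1 + G := by linarith
  have hK : volume (perronTree u n (Set.Ioc 0 n)) ≤
      ENNReal.ofReal ((G + 1) ^ 2 * (u (2 ^ n) - u 0) * n) := by
    -- With ρ = G / (1 + G), this choice makes `h₂` an equality and `α + β = (G + 1) ^ 2`.
    convert volume_perronTree_le (α := G + 1) (β := G * (G + 1)) hu.monotoneOn hb (by linarith)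
      (by positivity) ?_ ?_ using 4
    · ring
    · rw [div_mul_eq_mul_div, div_le_iff₀ hG1]; nlinarith
    · rw [div_mul_eq_mul_div, div_le_iff₀ hG1]; nlinarith
  have key := volume_le_of_le_directionalMaximal hp₀ hp hC
    (measurableSet_perronTree u n measurableSet_Ioc)
    (measurableSet_perronTree u n measurableSet_Ioc) (ne_top_of_le_ne_top ENNReal.ofReal_ne_top hK)
    (fun x hx => le_directionalMaximal_perronTree hn hu hΩ hx)
  rw [volume_perronTree_reflected hu.monotoneOn] at key
  replace key := key.trans (mul_le_mul_right hK _)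
  rw [← ENNReal.ofReal_toReal hCfin, ENNReal.ofReal_rpow_of_nonneg (by norm_num) (by positivity),
    ENNReal.ofReal_rpow_of_nonneg (by positivity) (by positivity),
    ← ENNReal.ofReal_mul (by positivity), ← ENNReal.ofReal_mul (by positivity),
    ENNReal.ofReal_le_ofReal_iff (by positivity)] at key
  refine le_of_mul_le_mul_right ?_ (mul_pos hΔ hn')
  linarith

theorem exists_slopes_of_perronCapacity_lt_top {Ω : Set ℝ} (hΩ : perronCapacity Ω < ∞) :
    ∃ G : ℝ, 0 ≤ G ∧ ∀ n₀ : ℕ, ∃ n ≥ n₀, ∃ u : ℕ → ℝ, StrictMonoOn u (Set.Iic (2 ^ n)) ∧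
      (∀ i ≤ 2 ^ n, u i ∈ Ω) ∧ DyadicallyBalanced u (2 ^ n) (G / (1 + G)) := by
  obtain ⟨G, hG, -⟩ := ENNReal.lt_iff_exists_nnreal_btwn.1 hΩ
  refine ⟨G, G.2, fun n₀ => ?_⟩
  obtain ⟨N, hN, hlt⟩ := frequently_atTop.1 (frequently_lt_of_liminf_lt isCobounded_ge_of_top hG)
    (n₀ + 1)
  simp only [iInf_lt_iff] at hlt
  obtain ⟨U, hUΩ, hcard, hU⟩ := hlt
  -- A tree with `2 ^ n` branches needs `2 ^ n + 1` slopes, so one exponent is given up.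
  obtain ⟨n, rfl⟩ : ∃ n, N = n + 1 := ⟨N - 1, by omega⟩
  have hpow : 0 < 2 ^ n := Nat.two_pow_pos n
  have hlt {i : ℕ} (hi : i ≤ 2 ^ n) : i < U.card := by rw [hcard, pow_succ]; omega
  let u : ℕ → ℝ := fun i => if h : i < U.card then U.orderEmbOfFin rfl ⟨i, h⟩ else 0
  have hu {i : ℕ} (h : i < U.card) : u i = U.orderEmbOfFin rfl ⟨i, h⟩ := dif_pos h
  have hmono : StrictMonoOn u (Set.Iic (2 ^ n)) := fun i hi j hj hij => by
    rw [hu (hlt hi), hu (hlt hj)]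
    exact (U.orderEmbOfFin rfl).strictMono hij
  refine ⟨n, by omega, u, hmono, fun i hi => ?_, dyadicallyBalanced_of_ratio_le hmono ?_⟩
  · rw [hu (hlt hi)]
    exact hUΩ (U.orderEmbOfFin_mem rfl _)
  · intro k l hl hkl
    have h3 := hlt hkl
    rw [hu h3, hu (show k + l < U.card by omega), hu (show k < U.card by omega)]
    have h4 : _ ≤ perronFactor U := le_iSup₂_of_le k l (le_iSup₂_of_le hl h3 le_rfl)
    have h5 := h4.trans hU.le
    rwa [ENNReal.ofReal_le_iff_le_toReal ENNReal.coe_ne_top] at h5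

theorem theorem2 (Ω : Set ℝ) (hΩ : perronCapacity Ω < ∞) (p : ℝ≥0∞) (hp₁ : 1 < p) (hp : p < ∞) :
    directionalMaximalNorm Ω p = ∞ := by
  refine sInf_eq_top.2 fun C hC => ?_
  by_contra hCfin
  obtain ⟨G, hG, h⟩ := exists_slopes_of_perronCapacity_lt_top hΩ
  have hc : (0 : ℝ) < (1 / 24) ^ p.toReal := by positivity
  obtain ⟨n₀, hn₀⟩ := exists_nat_gt (2 * C.toReal ^ p.toReal * (G + 1) ^ 2 / (1 / 24) ^ p.toReal)
  obtain ⟨n, hn, u, hu, huΩ, hb⟩ := h n₀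
  have hle := branching_le_of_directionalMaximal_bounded (zero_lt_one.trans hp₁).ne' hp.ne hCfin hC
    hG hu huΩ hb
  rw [mul_comm, ← le_div_iff₀ hc] at hle
  have : (n₀ : ℝ) ≤ n := by exact_mod_cast hn
  linarith
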